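/- **Notation.** An ordered distribution is a vector of non-negative reals with sum $1$ in non-increasing order; $\mathcal P_n$ is the set of those with $n$ components. For ordered distributions (of possibly different lengths, the shorter being padded with zeros) $\mathbf a\preceq\mathbf b$ means $\sum_{t\le i}a_t\le\sum_{t\le i}b_t$ for all $i$. $(\mathcal P_n,\preceq)$ has greatest lower bounds: $\mathbf z=\mathbf a\wedge\mathbf b$ is given by $\sum_{t\le i}z_t=\min\{\sum_{t\le i}a_t,\sum_{t\le i}b_t\}$ for all $i$. Let ${\rm half}(p_1,\dots,p_n)=(\frac{p_1}2,\frac{p_1}2,\dots,\frac{p_n}2,\frac{p_n}2)$ and let ${\rm half}^{(\ell)}$ be its $\ell$-fold iterate (${\rm half}^{(0)}$ is the identity). **The procedure $\mathrm{Split}(z,x,A[a\dots b])$.** Go through $A[a],A[a+1],\dots,A[b]$ in this order and collect indices into a set $Q$ as long as the collected sum together with the next entry is $<x$; stop at the first index where this fails. With $\sigma$ the collected sum, return $z^{(d)}=x-\sigma$, $z^{(r)}=z-z^{(d)}$ and $Q$. **The algorithm for two distributions.** Input: $\mathbf p,\mathbf q\in\mathcal P_n$ (after padding with zeros to a common length).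 Output: an $n\times n$ matrix $M$ with row sums $\mathbf p$ and column sums $\mathbf q$. If $\mathbf p\ne\mathbf q$ and $p_i<q_i$ at the last index $i$ with $p_i\neq q_i$, exchange $\mathbf p$ and $\mathbf q$ (and transpose the resulting matrix at the end). Let $\mathbf z=\mathbf p\wedge\mathbf q$. The inversion points $i_0=n+1>i_1>\dots>i_k=1$ are defined as follows: for odd (even) $s$, $i_s$ is the least index below $i_{s-1}$ such that $\sum_{t=i}^np_t\ge\sum_{t=i}^nq_t$ (respectively $\le$) for all $i\in\{i_s,\dots,i_{s-1}-1\}$. Start with $M=0$ and arrays $R=C=0$. For $s=1,\dots,k$ do the following. * If $s$ is odd: for $j=i_{s-1}-1$ down to $i_s$, let $(z_j^{(d)},z_j^{(r)},Q)=\mathrm{Split}(z_j,q_j,R[j+1\dots i_{s-1}-1])$; for each $t\in Q$ put $M_{t,j}\leftarrow R[t]$, $R[t]\leftarrow0$; then put $M_{j,j}\leftarrow z_j^{(d)}$, $R[j]\leftarrow z_j^{(r)}$. After this loop, if $i_s\ne1$, for each $t\in\{i_s,\dots,i_{s-1}-1\}$ with $R[t]\ne0$ put $M_{t,i_s-1}\leftarrow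 R[t]$, $R[t]\leftarrow 0$. * If $s$ is even: do the same with the roles of rows and columns, of $\mathbf p$ and $\mathbf q$, and of $R$ and $C$ exchanged. **The binary-tree algorithm.** Let $k=2^\kappa$ and $\mathbf p^{(1)},\dots,\mathbf p^{(k)}\in\mathcal P_n$. For $1\le i\le k$ let $\mathbf m^{(i-i)}=\mathbf p^{(i)}$. For $\ell=1,\dots,\kappa$ and each block $i=s2^\ell+1,\dots,j=(s+1)2^\ell$ with $0\le s<k/2^\ell$, let $j_1=i+2^{\ell-1}-1$, $j_2=j_1+1$, run the algorithm for two distributions on $\mathbf m^{(i-j_1)}$ and $\mathbf m^{(j_2-j)}$, and let $\mathbf m^{(i-j)}$ be the vector of the non-zero entries of the resulting matrix, sorted in non-increasing order. **Theorem.** For each $\ell=0,1,\dots,\kappa$ and $s=0,1,\dots,k/2^\ell-1$, with $i=s2^\ell+1$ and $j=(s+1)2^\ell$, the vector $\mathbf m^{(i-j)}$ is an ordered distribution and $${\rm half}^{(\ell)}\bigl(\mathbf p^{(i)}\wedge\mathbf p^{(i+1)}\wedge\dots\wedge\mathbf p^{(j)}\bigr)\preceq\mathbf m^{(i-j)}.$$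 -/

import Mathlib

namespace MinEntropy

/-! ### Ordered probability vectors and majorization -/

/-- `a` is a probability vector whose components are listed in non-increasing order. -/
def IsOrderedDist (a : List ℝ) : Prop :=
  a.Pairwise (fun x y => y ≤ x) ∧ (∀ x ∈ a, 0 ≤ x) ∧ a.sum = 1

/-- The sum of the first `i` components. For `i` beyond the length this is the sum of all
components, i.e. the vector is implicitly padded with zeros. -/
def prefixSum (a : List ℝ) (i : ℕ) : ℝ := (a.take i).sum

/-- Majorization `a ⪯ b` between ordered probability vectors, of possibly different lengths. -/
def Majorized (a b : List ℝ) : Prop :=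
  IsOrderedDist a ∧ IsOrderedDist b ∧ ∀ i : ℕ, prefixSum a i ≤ prefixSum b i

/-- The set `𝒫ₙ` of ordered probability vectors with `n` components. -/
@[ext] structure OrderedDist (n : ℕ) where
  toList : List ℝ
  length_eq : toList.length = n
  ordered : IsOrderedDist toList

/-- The vector `z` with `z₁ + ⋯ + zᵢ = min (a₁ + ⋯ + aᵢ) (b₁ + ⋯ + bᵢ)` for all `i`. -/
noncomputable def meet (a b : List ℝ) : List ℝ :=
  (List.range (max a.length b.length)).map fun i =>
    min (prefixSum a (i + 1)) (prefixSum b (i + 1)) - min (prefixSum a i) (prefixSum b i)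

theorem prefixSum_zero (a : List ℝ) : prefixSum a 0 = 0 := by simp [prefixSum]

theorem prefixSum_of_le {a : List ℝ} {i : ℕ} (h : a.length ≤ i) : prefixSum a i = a.sum := by
  simp [prefixSum, List.take_of_length_le h]

theorem prefixSum_succ (a : List ℝ) (i : ℕ) :
    prefixSum a (i + 1) = prefixSum a i + a.getD i 0 := by
  unfold prefixSum
  rw [List.take_add_one, List.sum_append, List.getD_eq_getElem?_getD]
  cases a[i]? <;> simp

theorem length_meet (a b : List ℝ) : (meet a b).length = max a.length b.length := by
  simp [meet]

theorem prefixSum_meet (a b : List ℝ) (i : ℕ) :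
    prefixSum (meet a b) i = min (prefixSum a i) (prefixSum b i) := by
  induction i with
  | zero => simp [prefixSum_zero]
  | succ i ih =>
    rw [prefixSum_succ, ih]
    by_cases h : i < max a.length b.length
    · have : (meet a b).getD i 0 = min (prefixSum a (i + 1)) (prefixSum b (i + 1))
          - min (prefixSum a i) (prefixSum b i) := by
        rw [List.getD_eq_getElem _ _ (by rwa [length_meet])]
        simp [meet]
      rw [this]; ring
    · have h1 : max a.length b.length ≤ i := not_lt.mp h
      have h2 : (meet a b).getD i 0 = 0 := List.getD_eq_default _ _ (by rwa [length_meet])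
      have ha : a.length ≤ i := (le_max_left _ _).trans h1
      have hb : b.length ≤ i := (le_max_right _ _).trans h1
      rw [h2, prefixSum_of_le ha, prefixSum_of_le hb, prefixSum_of_le (ha.trans (Nat.le_succ i)),
        prefixSum_of_le (hb.trans (Nat.le_succ i)), add_zero]

theorem IsOrderedDist.getD_nonneg {a : List ℝ} (ha : IsOrderedDist a) (i : ℕ) :
    0 ≤ a.getD i 0 := by
  by_cases h : i < a.length
  · rw [List.getD_eq_getElem _ _ h]
    exact ha.2.1 _ (List.getElem_mem h)
  · rw [List.getD_eq_default _ _ (not_lt.mp h)]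

theorem IsOrderedDist.getD_anti {a : List ℝ} (ha : IsOrderedDist a) (i : ℕ) :
    a.getD (i + 1) 0 ≤ a.getD i 0 := by
  by_cases h : i + 1 < a.length
  · rw [List.getD_eq_getElem _ _ h, List.getD_eq_getElem _ _ (Nat.lt_of_succ_lt h)]
    exact List.pairwise_iff_getElem.mp ha.1 _ _ _ _ (Nat.lt_succ_self i)
  · rw [List.getD_eq_default _ _ (not_lt.mp h)]
    exact ha.getD_nonneg i

theorem meet_isOrderedDist {a b : List ℝ} (ha : IsOrderedDist a) (hb : IsOrderedDist b) :
    IsOrderedDist (meet a b) := by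
  refine ⟨?_, ?_, ?_⟩
  · have hc : (meet a b).IsChain (fun x y => y ≤ x) := by
      rw [List.isChain_iff_getElem]
      intro i hi
      have e1 := prefixSum_succ a i
      have e2 := prefixSum_succ b i
      have e3 := prefixSum_succ a (i + 1)
      have e4 := prefixSum_succ b (i + 1)
      have d1 := ha.getD_anti i
      have d2 := hb.getD_anti i
      simp only [meet, List.getElem_map, List.getElem_range]
      rcases min_cases (prefixSum a (i + 1)) (prefixSum b (i + 1)) with h | h <;>
      rcases min_cases (prefixSum a i) (prefixSum b i) with h' | h' <;>
      rcases min_cases (prefixSum a (i + 1 + 1)) (prefixSum b (i + 1 + 1)) with h'' | h'' <;>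
      linarith [h.1, h'.1, h''.1, h.2, h'.2, h''.2]
    have : IsTrans ℝ (fun x y => y ≤ x) := ⟨fun _ _ _ h h' => le_trans h' h⟩
    exact List.isChain_iff_pairwise.mp hc
  · intro x hx
    simp only [meet, List.mem_map] at hx
    obtain ⟨i, -, rfl⟩ := hx
    rw [sub_nonneg, prefixSum_succ, prefixSum_succ]
    exact min_le_min (le_add_of_nonneg_right (ha.getD_nonneg i))
      (le_add_of_nonneg_right (hb.getD_nonneg i))
  · rw [← prefixSum_of_le (le_refl (meet a b).length), prefixSum_meet, length_meet,
      prefixSum_of_le (le_max_left _ _), prefixSum_of_le (le_max_right _ _), ha.2.2, hb.2.2,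
      min_self]

/-- `𝒫ₙ` is partially ordered by majorization. -/
instance instPartialOrderOrderedDist (n : ℕ) : PartialOrder (OrderedDist n) where
  le p q := Majorized p.toList q.toList
  le_refl p := ⟨p.ordered, p.ordered, fun _ => le_rfl⟩
  le_trans _ _ _ h h' := ⟨h.1, h'.2.1, fun i => (h.2.2 i).trans (h'.2.2 i)⟩
  le_antisymm p q h h' := by
    have e : ∀ i, prefixSum p.toList i = prefixSum q.toList i :=
      fun i => le_antisymm (h.2.2 i) (h'.2.2 i)
    ext1
    refine List.ext_getElem (p.length_eq.trans q.length_eq.symm) fun i hp hq => ?_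
    have e1 := prefixSum_succ p.toList i
    have e2 := prefixSum_succ q.toList i
    rw [List.getD_eq_getElem _ _ hp] at e1
    rw [List.getD_eq_getElem _ _ hq] at e2
    linarith [e i, e (i + 1)]

/-- `meet` is the greatest lower bound for majorization, so `⊓` on `𝒫ₙ` is the lattice meet. -/
noncomputable instance instSemilatticeInfOrderedDist (n : ℕ) : SemilatticeInf (OrderedDist n) where
  inf p q := ⟨meet p.toList q.toList, by rw [length_meet, p.length_eq, q.length_eq, max_self],
    meet_isOrderedDist p.ordered q.ordered⟩
  inf_le_left p q := ⟨meet_isOrderedDist p.ordered q.ordered, p.ordered,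
    fun i => (prefixSum_meet _ _ i).trans_le (min_le_left _ _)⟩
  inf_le_right p q := ⟨meet_isOrderedDist p.ordered q.ordered, q.ordered,
    fun i => (prefixSum_meet _ _ i).trans_le (min_le_right _ _)⟩
  le_inf _ q r h h' := ⟨h.1, meet_isOrderedDist q.ordered r.ordered,
    fun i => (le_min (h.2.2 i) (h'.2.2 i)).trans_eq (prefixSum_meet _ _ i).symm⟩

/-- `half (p₁, …, pₙ) = (p₁/2, p₁/2, …, pₙ/2, pₙ/2)`. -/
noncomputable def half (a : List ℝ) : List ℝ := a.flatMap fun x => [x / 2, x / 2]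

/-! ### The algorithm for two distributions

Vectors are read with indices starting at `1`; components beyond the length are `0`, which is the
padding of the shorter input to the common length. -/

/-- The component with (one-based) index `i`. -/
noncomputable def comp (a : List ℝ) (i : ℕ) : ℝ := if i = 0 then 0 else a.getD (i - 1) 0

/-- The suffix sum `∑_{k = i}^{N} p_k`. -/
noncomputable def suffixSum (N : ℕ) (p : ℕ → ℝ) (i : ℕ) : ℝ := ∑ k ∈ Finset.Icc i N, p k

/-- The least index `l` with `1 ≤ l < u` such that the suffix sums of `p` are at least those of `q`
at all indices `l, …, u - 1`. -/
noncomputable def nextInversion (N : ℕ) (p q : ℕ → ℝ) (u : ℕ) : ℕ :=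
  sInf {l | 1 ≤ l ∧ l < u ∧ ∀ i, l ≤ i → i < u → suffixSum N q i ≤ suffixSum N p i}

/-- The inversion points `i₀ = N + 1 > i₁ > i₂ > ⋯`. -/
noncomputable def inversionPoint (N : ℕ) (p q : ℕ → ℝ) : ℕ → ℕ
  | 0 => N + 1
  | s + 1 =>
    if Odd (s + 1) then nextInversion N p q (inversionPoint N p q s)
    else nextInversion N q p (inversionPoint N p q s)

/-- The index `k` of the last inversion point `i_k = 1`. -/
noncomputable def inversionCount (N : ℕ) (p q : ℕ → ℝ) : ℕ := sInf {s | inversionPoint N p q s = 1}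

/-- The `while` loop of the splitting procedure: going through the indices in the given order, it
collects `k` as long as the collected total plus `A k` stays below `x`. It returns the set of
collected indices and the collected total. -/
noncomputable def collect (x : ℝ) (A : ℕ → ℝ) : List ℕ → Finset ℕ → ℝ → Finset ℕ × ℝ
  | [], Q, total => (Q, total)
  | k :: ks, Q, total =>
    if total + A k < x then collect x A ks (insert k Q) (total + A k) else (Q, total)

/-- The output `(z⁽ᵈ⁾, z⁽ʳ⁾, Q)` of the splitting procedure. -/
structure Split where
  d : ℝ
  r : ℝ
  Q : Finset ℕ

/-- The splitting procedure applied to `z`, `x` and the array segment `A[lo], …, A[hi - 1]`. -/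
noncomputable def split (z x : ℝ) (A : ℕ → ℝ) (lo hi : ℕ) : Split :=
  let c := collect x A (List.range' lo (hi - lo)) ∅ 0
  { d := x - c.2, r := z - (x - c.2), Q := c.1 }

/-- The variables of the algorithm: the matrix and the auxiliary arrays. -/
structure State where
  M : ℕ → ℕ → ℝ
  R : ℕ → ℝ
  C : ℕ → ℝ

/-- Exchange the roles of rows and columns. -/
def State.swap (st : State) : State := { M := fun a b => st.M b a, R := st.C, C := st.R }

/-- The body of the inner loop for the index `j` in the segment `l, …, u - 1`, odd case:
`M[t, j] ← R[t]` and `R[t] ← 0` for `t ∈ Q`, then `M[j, j] ← z⁽ᵈ⁾` and `R[j] ← z⁽ʳ⁾`. -/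
noncomputable def innerStep (q z : ℕ → ℝ) (u : ℕ) (st : State) (j : ℕ) : State :=
  let sp := split (z j) (q j) st.R (j + 1) u
  { M := fun a b =>
      if a = j ∧ b = j then sp.d else if a ∈ sp.Q ∧ b = j then st.R a else st.M a b
    R := fun a => if a = j then sp.r else if a ∈ sp.Q then 0 else st.R a
    C := st.C }

/-- The move after the inner loop, odd case: if `l ≠ 1`, then for all `t ∈ {l, …, u - 1}` with
`R[t] ≠ 0` do `M[t, l - 1] ← R[t]` and `R[t] ← 0`. -/
noncomputable def flush (l u : ℕ) (st : State) : State :=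
  if l ≠ 1 then
    { M := fun a b => if (l ≤ a ∧ a < u ∧ st.R a ≠ 0) ∧ b = l - 1 then st.R a else st.M a b
      R := fun a => if l ≤ a ∧ a < u then 0 else st.R a
      C := st.C }
  else st

/-- One iteration of the main loop, odd case: `j` runs from `u - 1` down to `l`. -/
noncomputable def oddStage (q z : ℕ → ℝ) (l u : ℕ) (st : State) : State :=
  flush l u ((List.range' l (u - l)).reverse.foldl (innerStep q z u) st)

/-- One iteration of the main loop, even case: rows and columns, `p` and `q`, and `R` and `C`
exchange their roles. -/
noncomputable def evenStage (p z : ℕ → ℝ) (l u : ℕ) (st : State) : State :=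
  (oddStage p z l u st.swap).swap

/-- The iteration of the main loop with counter `s ≥ 1`. -/
noncomputable def stage (N : ℕ) (p q z : ℕ → ℝ) (st : State) (s : ℕ) : State :=
  if Odd s then oddStage q z (inversionPoint N p q s) (inversionPoint N p q (s - 1)) st
  else evenStage p z (inversionPoint N p q s) (inversionPoint N p q (s - 1)) st

/-- The algorithm after the initial exchange of the inputs: the main loop, `s = 1, …, k`. -/
noncomputable def jointCore (a b : List ℝ) : ℕ → ℕ → ℝ :=
  let N := max a.length b.length
  let p := comp a
  let q := comp b
  ((List.range' 1 (inversionCount N p q)).foldl (stage N p q (comp (meet a b)))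
    { M := fun _ _ => 0, R := fun _ => 0, C := fun _ => 0 }).M

/-- The two vectors differ, and at the last index where they differ the first one is smaller. -/
def NeedsSwap (N : ℕ) (p q : ℕ → ℝ) : Prop :=
  ∃ i ∈ Finset.Icc 1 N, p i < q i ∧ ∀ j ∈ Finset.Ioc i N, p j = q j

open Classical in
/-- The algorithm for two distributions. If the inputs are exchanged at the beginning, the resulting
matrix is transposed, so that rows always belong to `a` and columns to `b`. -/
noncomputable def minEntropyJoint (a b : List ℝ) : ℕ → ℕ → ℝ :=
  if NeedsSwap (max a.length b.length) (comp a) (comp b) then fun s t => jointCore b a t s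
  else jointCore a b

/-! ### The binary-tree algorithm -/

/-- Rearrangement in non-increasing order. -/
noncomputable def sortDesc (a : List ℝ) : List ℝ := a.mergeSort fun x y => decide (y ≤ x)

/-- The entries `M[s, t]`, `1 ≤ s ≤ n`, `1 ≤ t ≤ m`, row by row. -/
def entries (M : ℕ → ℕ → ℝ) (n m : ℕ) : List ℝ :=
  (List.range' 1 n).flatMap fun s => (List.range' 1 m).map fun t => M s t

/-- An internal node of the tree: the non-zero entries of the joint distribution of the
distributions at the two children, in non-increasing order. -/
noncomputable def combine (a b : List ℝ) : List ℝ :=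
  sortDesc ((entries (minEntropyJoint a b) a.length b.length).filter fun x => decide (x ≠ 0))

/-- The vector `m^(i-j)` with `j = i + 2 ^ ℓ - 1`, which the algorithm builds at level `ℓ` for the
block `p^(i), …, p^(j)`. -/
noncomputable def blockJoint {n : ℕ} (p : ℕ → OrderedDist n) : ℕ → ℕ → List ℝ
  | 0, i => sortDesc (p i).toList
  | ℓ + 1, i => combine (blockJoint p ℓ i) (blockJoint p ℓ (i + 2 ^ ℓ))

theorem block_nonempty (ℓ s : ℕ) : (Finset.Icc (s * 2 ^ ℓ + 1) ((s + 1) * 2 ^ ℓ)).Nonempty := by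
  rw [Finset.nonempty_Icc, add_mul, one_mul]
  exact Nat.add_le_add_left Nat.one_le_two_pow _

/-- The meet `p^(i) ∧ ⋯ ∧ p^(j)` in `𝒫ₙ` over the block `i = s 2^ℓ + 1, …, j = (s + 1) 2^ℓ`. -/
noncomputable def blockMeet {n : ℕ} (p : ℕ → OrderedDist n) (ℓ s : ℕ) : OrderedDist n :=
  (Finset.Icc (s * 2 ^ ℓ + 1) ((s + 1) * 2 ^ ℓ)).inf' (block_nonempty ℓ s) p

end MinEntropy

/-!
Why the bound holds: for two distributions with meet `z`, the algorithm cuts every component `z t`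
into two non-negative parts `z⁽ᵈ⁾` and `z⁽ʳ⁾` and stores each part, unchanged, in a cell of its own.
The first part goes to the diagonal cell `(t, t)`. The second one waits in `R[t]` (or `C[t]`) until
it is moved as a whole to a cell to the left of the diagonal (or above it). Hence the hook formed by
the cells `(a, b)` with `max a b = t` contains at most two non-zero entries, and these sum to `z t`
(`HookSplit`). As distinct hooks are disjoint, the `2 * i` cells of the first `i` hooks have the sum
`z 1 + ⋯ + z i`, and the larger entry of the next hook adds at least `z (i + 1) / 2`. Since the
sorted vector maximizes sums over a given number of cells, this is `half z ⪯ combine a b`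
(`half_meet_majorized_combine`).

Non-negativity of the parts is the point where the splitting procedure matters
(`FilledFrom.innerStep`). If it stops at an index `w` inside the segment, then `z⁽ᵈ⁾` is at most the
rest waiting at `w`, which is at most `z w ≤ z j`. If it exhausts the segment, then `z⁽ᵈ⁾ ≤ z j` is
the balance of masses, because between two inversion points the suffix sums of `z` are those of the
dominating input (`HooksFrom.oddStage`). The same balance shows that nothing is left waiting at the
end, where both inputs have total mass `1`. The main loop alternates between the two inputs, and its
invariant `HooksFrom` is symmetric under transposition, so only odd stages have to be analysed.

For the tree, `half` is monotone, and by induction both children of a node majorize `half^[ℓ]` of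
the meet over the whole block; hence so does their meet, and one more `half` gives the claim.
-/

namespace MinEntropy

/-! ### Prefix sums, halving and sorting -/

theorem half_cons (x : ℝ) (a : List ℝ) : half (x :: a) = x / 2 :: x / 2 :: half a := rfl

theorem prefixSum_cons_succ (x : ℝ) (a : List ℝ) (i : ℕ) :
    prefixSum (x :: a) (i + 1) = x + prefixSum a i := by
  simp [prefixSum]

theorem prefixSum_half_even (a : List ℝ) (i : ℕ) :
    prefixSum (half a) (2 * i) = prefixSum a i := by
  induction a generalizing i with
  | nil => simp [prefixSum, half]
  | cons x a ih =>
    cases i with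
    | zero => simp [prefixSum]
    | succ i =>
      rw [half_cons, show 2 * (i + 1) = 2 * i + 1 + 1 by ring, prefixSum_cons_succ,
        prefixSum_cons_succ, prefixSum_cons_succ, ih]
      ring

theorem prefixSum_half_odd (a : List ℝ) (i : ℕ) :
    prefixSum (half a) (2 * i + 1) = (prefixSum a i + prefixSum a (i + 1)) / 2 := by
  induction a generalizing i with
  | nil => simp [prefixSum, half]
  | cons x a ih =>
    cases i with
    | zero => simp [prefixSum, half_cons]
    | succ i =>
      rw [half_cons, show 2 * (i + 1) + 1 = 2 * i + 1 + 1 + 1 by ring, prefixSum_cons_succ,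
        prefixSum_cons_succ, prefixSum_cons_succ, prefixSum_cons_succ, ih]
      ring

theorem half_isOrderedDist {a : List ℝ} (ha : IsOrderedDist a) : IsOrderedDist (half a) := by
  obtain ⟨h1, h2, h3⟩ := ha
  refine ⟨?_, ?_, ?_⟩
  · clear h2 h3
    induction a with
    | nil => simp [half]
    | cons x a ih =>
      rw [List.pairwise_cons] at h1
      have h : ∀ y ∈ half a, y ≤ x / 2 := by
        intro y hy
        simp only [half, List.mem_flatMap, List.mem_cons, List.not_mem_nil, or_false, or_self]
          at hy
        obtain ⟨w, hw, rfl⟩ := hy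
        linarith [h1.1 w hw]
      rw [half_cons, List.pairwise_cons, List.pairwise_cons]
      refine ⟨fun y hy => ?_, h, ih h1.2⟩
      rcases List.mem_cons.mp hy with rfl | hy
      exacts [le_rfl, h y hy]
  · intro y hy
    simp only [half, List.mem_flatMap, List.mem_cons, List.not_mem_nil, or_false, or_self] at hy
    obtain ⟨w, hw, rfl⟩ := hy
    linarith [h2 w hw]
  · rw [← h3]
    clear h1 h2 h3
    induction a with
    | nil => simp [half]
    | cons x a ih =>
      rw [half_cons, List.sum_cons, List.sum_cons, List.sum_cons, ih]
      ring

theorem Majorized.trans {a b c : List ℝ} (h : Majorized a b) (h' : Majorized b c) :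
    Majorized a c :=
  ⟨h.1, h'.2.1, fun i => (h.2.2 i).trans (h'.2.2 i)⟩

theorem Majorized.half_mono {a b : List ℝ} (h : Majorized a b) :
    Majorized (half a) (half b) := by
  refine ⟨half_isOrderedDist h.1, half_isOrderedDist h.2.1, fun i => ?_⟩
  obtain ⟨k, rfl | rfl⟩ := Nat.even_or_odd' i
  · rw [prefixSum_half_even, prefixSum_half_even]
    exact h.2.2 k
  · rw [prefixSum_half_odd, prefixSum_half_odd]
    linarith [h.2.2 k, h.2.2 (k + 1)]

theorem Majorized.half_iterate_mono {a b : List ℝ} (h : Majorized a b) (ℓ : ℕ) :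
    Majorized (half^[ℓ] a) (half^[ℓ] b) := by
  induction ℓ with
  | zero => exact h
  | succ ℓ ih =>
    rw [Function.iterate_succ_apply', Function.iterate_succ_apply']
    exact ih.half_mono

theorem Majorized.le_meet {a b c : List ℝ} (h : Majorized a b) (h' : Majorized a c) :
    Majorized a (meet b c) :=
  ⟨h.1, meet_isOrderedDist h.2.1 h'.2.1, fun i =>
    (le_min (h.2.2 i) (h'.2.2 i)).trans_eq (prefixSum_meet b c i).symm⟩

theorem sortDesc_perm (a : List ℝ) : (sortDesc a).Perm a := List.mergeSort_perm _ _

theorem sortDesc_pairwise (a : List ℝ) : (sortDesc a).Pairwise (fun x y => y ≤ x) := by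
  have h := List.pairwise_mergeSort (le := fun x y : ℝ => decide (y ≤ x))
    (fun x y w h h' => by
      simp only [decide_eq_true_eq] at h h' ⊢
      exact h'.trans h)
    (fun x y => by simpa using le_total y x) a
  simpa [sortDesc] using h

theorem sortDesc_of_pairwise {a : List ℝ} (h : a.Pairwise (fun x y => y ≤ x)) :
    sortDesc a = a :=
  List.mergeSort_of_pairwise (by simpa using h)

/-- Among all choices of at most `i` entries of a non-increasing non-negative vector, the first
`i` entries have the largest sum. -/
theorem sum_le_prefixSum {a : List ℝ} (ha : a.Pairwise (fun x y => y ≤ x))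
    (h0 : ∀ x ∈ a, 0 ≤ x) {S : Multiset ℝ} (hS : S ≤ (a : Multiset ℝ)) {i : ℕ}
    (hi : S.card ≤ i) : S.sum ≤ prefixSum a i := by
  induction a generalizing S i with
  | nil =>
    obtain rfl : S = 0 := by simpa using hS
    simp [prefixSum]
  | cons x a ih =>
    rw [List.pairwise_cons] at ha
    rw [List.forall_mem_cons] at h0
    rcases Multiset.empty_or_exists_mem S with rfl | ⟨y, hy⟩
    · rw [Multiset.sum_zero]
      refine List.sum_nonneg fun w hw => ?_
      rcases List.mem_cons.mp (List.mem_of_mem_take hw) with rfl | hw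
      exacts [h0.1, h0.2 w hw]
    · obtain ⟨y, hy, hyx, hle⟩ : ∃ y ∈ S, y ≤ x ∧ S.erase y ≤ (a : Multiset ℝ) := by
        rw [← Multiset.cons_coe] at hS
        by_cases hx : x ∈ S
        · exact ⟨x, hx, le_rfl, Multiset.erase_le_iff_le_cons.mpr hS⟩
        · have h := (Multiset.le_cons_of_notMem hx).mp hS
          exact ⟨y, hy, ha.1 y (Multiset.mem_coe.mp (Multiset.mem_of_le h hy)),
            (Multiset.erase_le _ _).trans h⟩
      obtain ⟨k, rfl⟩ : ∃ k, i = k + 1 :=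
        Nat.exists_eq_add_one.mpr ((Multiset.card_pos_iff_exists_mem.mpr ⟨y, hy⟩).trans_le hi)
      have h := ih ha.2 h0.2 hle (i := k) (by
        rw [Multiset.card_erase_of_mem hy, Nat.pred_eq_sub_one]
        omega)
      rw [prefixSum_cons_succ, ← Multiset.cons_erase hy, Multiset.sum_cons]
      exact add_le_add hyx h

/-! ### Components and their suffix sums -/

theorem comp_succ (a : List ℝ) (i : ℕ) : comp a (i + 1) = a.getD i 0 := by simp [comp]

theorem comp_nonneg {a : List ℝ} (ha : IsOrderedDist a) (i : ℕ) : 0 ≤ comp a i := by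
  cases i with
  | zero => simp [comp]
  | succ i => rw [comp_succ]; exact ha.getD_nonneg i

theorem comp_anti {a : List ℝ} (ha : IsOrderedDist a) {i j : ℕ} (hi : 1 ≤ i) (hij : i ≤ j) :
    comp a j ≤ comp a i := by
  induction j, hij using Nat.le_induction with
  | base => exact le_rfl
  | succ j hj ih =>
    obtain ⟨k, rfl⟩ := Nat.exists_eq_add_one.mpr (hi.trans hj)
    refine le_trans ?_ ih
    rw [comp_succ, comp_succ]
    exact ha.getD_anti k

theorem mem_Icc_of_comp_pos {a : List ℝ} {i : ℕ} (h : 0 < comp a i) :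
    i ∈ Finset.Icc 1 a.length := by
  cases i with
  | zero => simp [comp] at h
  | succ i =>
    rw [comp_succ] at h
    rw [Finset.mem_Icc]
    by_contra hc
    rw [List.getD_eq_default _ _ (by omega)] at h
    exact lt_irrefl _ h

theorem prefixSum_succ_eq_comp (a : List ℝ) (i : ℕ) :
    prefixSum a (i + 1) = prefixSum a i + comp a (i + 1) := by
  rw [prefixSum_succ, comp_succ]

theorem sum_Ico_comp (a : List ℝ) {i j : ℕ} (h : i ≤ j) :
    ∑ k ∈ Finset.Ico (i + 1) (j + 1), comp a k = prefixSum a j - prefixSum a i := by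
  induction j, h using Nat.le_induction with
  | base => simp
  | succ j hj ih =>
    rw [Finset.sum_Ico_succ_top (by omega), ih, prefixSum_succ_eq_comp]
    ring

theorem suffixSum_eq_sum_Ico (N : ℕ) (p : ℕ → ℝ) (i : ℕ) :
    suffixSum N p i = ∑ k ∈ Finset.Ico i (N + 1), p k := by
  rfl

theorem suffixSum_comp {a : List ℝ} (ha : IsOrderedDist a) {N : ℕ} (hN : a.length ≤ N) {i : ℕ}
    (hi : 1 ≤ i) (hiN : i ≤ N + 1) : suffixSum N (comp a) i = 1 - prefixSum a (i - 1) := by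
  obtain ⟨k, rfl⟩ := Nat.exists_eq_add_one.mpr hi
  rw [suffixSum_eq_sum_Ico, sum_Ico_comp a (by omega), prefixSum_of_le hN, ha.2.2]
  rfl

theorem sum_Ico_eq_suffixSum_sub (p : ℕ → ℝ) {N i u : ℕ} (h : i ≤ u) (hu : u ≤ N + 1) :
    ∑ k ∈ Finset.Ico i u, p k = suffixSum N p i - suffixSum N p u := by
  rw [suffixSum_eq_sum_Ico, suffixSum_eq_sum_Ico, ← Finset.sum_Ico_consecutive p h hu]
  ring

theorem length_pos_of_isOrderedDist {a : List ℝ} (ha : IsOrderedDist a) : 0 < a.length := by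
  rw [List.length_pos_iff]
  rintro rfl
  have := ha.2.2
  simp at this

/-! ### One segment of the main loop -/

theorem collect_spec (x : ℝ) (A : ℕ → ℝ) (n lo : ℕ) (Q : Finset ℕ) (σ : ℝ) :
    ∃ m ≤ n, collect x A (List.range' lo n) Q σ
        = (Q ∪ Finset.Ico lo (lo + m), σ + ∑ k ∈ Finset.Ico lo (lo + m), A k) ∧
      (m = n ∨ x ≤ σ + ∑ k ∈ Finset.Ico lo (lo + m), A k + A (lo + m)) ∧
      (m = 0 ∨ σ + ∑ k ∈ Finset.Ico lo (lo + m), A k < x) := by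
  induction n generalizing lo Q σ with
  | zero => exact ⟨0, le_rfl, by simp [collect], Or.inl rfl, Or.inl rfl⟩
  | succ n ih =>
    rw [List.range'_succ, collect]
    split_ifs with h
    · obtain ⟨m, hm, h1, h2, h3⟩ := ih (lo + 1) (insert lo Q) (σ + A lo)
      have e : lo + 1 + m = lo + (m + 1) := by ring
      have hs : ∑ k ∈ Finset.Ico lo (lo + (m + 1)), A k
          = A lo + ∑ k ∈ Finset.Ico (lo + 1) (lo + (m + 1)), A k :=
        Finset.sum_eq_sum_Ico_succ_bot (by omega) A
      rw [e] at h1 h2 h3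
      refine ⟨m + 1, by omega, ?_, ?_, Or.inr ?_⟩
      · rw [h1, hs, ← add_assoc σ, ← Finset.insert_Ico_add_one_left_eq_Ico (a := lo) (by omega),
          Finset.insert_union, Finset.union_insert]
      · rw [hs, ← add_assoc]
        exact h2.imp (fun h => by omega) id
      · rw [hs, ← add_assoc]
        rcases h3 with rfl | h3
        · simpa using h
        · exact h3
    · exact ⟨0, Nat.zero_le _, by simp, Or.inr (by simpa using h), Or.inl rfl⟩

/-- The splitting procedure collects an initial part `lo, …, w - 1` of the segment. -/
theorem split_spec (z x : ℝ) (A : ℕ → ℝ) {lo hi : ℕ} (h : lo ≤ hi) :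
    ∃ w, lo ≤ w ∧ w ≤ hi ∧ (split z x A lo hi).Q = Finset.Ico lo w ∧
      (split z x A lo hi).d = x - ∑ k ∈ Finset.Ico lo w, A k ∧
      (split z x A lo hi).r = z - (split z x A lo hi).d ∧
      (w = hi ∨ x ≤ ∑ k ∈ Finset.Ico lo w, A k + A w) ∧
      (w = lo ∨ ∑ k ∈ Finset.Ico lo w, A k < x) := by
  obtain ⟨m, hm, h1, h2, h3⟩ := collect_spec x A (hi - lo) lo ∅ 0
  refine ⟨lo + m, by omega, by omega, ?_, ?_, rfl, ?_, ?_⟩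
  · simp [split, h1]
  · simp [split, h1]
  · exact h2.imp (fun h => by omega) (fun h => by simpa using h)
  · exact h3.imp (fun h => by omega) (fun h => by simpa using h)

/-- The mass `w` assigned to the index `t` consists of the diagonal entry `f t`, of at most one
other non-zero entry `f c` of the row `f` with `c < t`, and of a non-negative pending rest `r`. As
long as the rest is non-zero, the diagonal entry is the only non-zero one. -/
def RowSplit (f : ℕ → ℝ) (r w : ℝ) (t : ℕ) : Prop :=
  0 ≤ r ∧ 0 ≤ f t ∧ ∃ c < t, 0 ≤ f c ∧ f t + f c + r = w ∧ (r ≠ 0 → f c = 0) ∧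
    ∀ c' < t, c' ≠ c → f c' = 0

/-- The rest is moved as a whole to a free place. -/
theorem RowSplit.move {f g : ℕ → ℝ} {r w : ℝ} {t d : ℕ} (h : RowSplit f r w t) (hd : d < t)
    (h0 : f d = 0) (hg : g d = r) (hgf : ∀ c, c ≠ d → g c = f c) : RowSplit g 0 w t := by
  obtain ⟨hr, ht, c, hc, hfc, hsum, hrc, hz⟩ := h
  refine ⟨le_rfl, by rwa [hgf t hd.ne'], ?_⟩
  by_cases hr0 : r = 0
  · have e : g = f := by
      funext x
      by_cases hx : x = d
      · rw [hx, hg, h0, hr0]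
      · exact hgf x hx
    rw [e]
    exact ⟨c, hc, hfc, by rw [← hsum, hr0], fun h => absurd rfl h, hz⟩
  · refine ⟨d, hd, hg ▸ hr, ?_, fun h => absurd rfl h, fun c' hc' hne => ?_⟩
    · rw [hg, hgf t hd.ne', ← hsum, hrc hr0]
      ring
    · rw [hgf c' hne]
      by_cases hcc : c' = c
      · rw [hcc, hrc hr0]
      · exact hz c' hc' hcc

theorem RowSplit.rest_le {f : ℕ → ℝ} {r w : ℝ} {t : ℕ} (h : RowSplit f r w t) : r ≤ w := by
  obtain ⟨_, _, c, _, _, hsum, _⟩ := h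
  linarith

/-- The state reached from `st₀` in a segment with upper end `u` (exclusive), odd case, when the
columns `v, …, u - 1` have been filled. -/
structure FilledFrom (q z : ℕ → ℝ) (u : ℕ) (st₀ : State) (v : ℕ) (st : State) : Prop where
  unchanged : ∀ a b, ¬ (v ≤ b ∧ b ≤ a ∧ a < u) → st.M a b = st₀.M a b
  rowSplit : ∀ t, v ≤ t → t < u → RowSplit (st.M t) (st.R t) (z t) t
  balance : ∑ t ∈ Finset.Ico v u, q t + ∑ t ∈ Finset.Ico v u, st.R t = ∑ t ∈ Finset.Ico v u, z t
  support : ∀ a b, v ≤ b → b ≤ a → a < u → st.M a b ≠ 0 → 0 < z a ∧ 0 < q b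

/-- Filling one more column keeps all masses non-negative, provided that the masses `z` in the
segment suffice for the column sums `q`. -/
theorem FilledFrom.innerStep {q z : ℕ → ℝ} {u v : ℕ} {st₀ st : State}
    (h : FilledFrom q z u st₀ (v + 1) st) (hv : 1 ≤ v) (hvu : v < u)
    (hq : 0 ≤ q v) (hz : ∀ t, v ≤ t → t < u → z t ≤ z v)
    (h0 : ∀ a b, a < u → b < u → st₀.M a b = 0)
    (hle : ∑ t ∈ Finset.Ico v u, q t ≤ ∑ t ∈ Finset.Ico v u, z t) :
    FilledFrom q z u st₀ v (innerStep q z u st v) := by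
  obtain ⟨w, hw1, hw2, hQ, hd, hr, hlast, hcont⟩ :=
    split_spec (z v) (q v) st.R (show v + 1 ≤ u from hvu)
  set sp := split (z v) (q v) st.R (v + 1) u with hsp
  have hR : ∀ t, v + 1 ≤ t → t < u → 0 ≤ st.R t := fun t h1 h2 => (h.rowSplit t h1 h2).1
  have hqs := Finset.sum_eq_sum_Ico_succ_bot hvu q
  have hzs := Finset.sum_eq_sum_Ico_succ_bot hvu z
  have hbal := h.balance
  have hd0 : 0 ≤ sp.d := by
    rcases hcont with rfl | hc
    · rw [hd]; simpa using hq
    · rw [hd]; linarith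
  have hr0 : 0 ≤ sp.r := by
    rw [hr, sub_nonneg]
    rcases lt_or_eq_of_le hw2 with hwu | rfl
    -- The procedure stopped at `w`, so `d` is at most the rest at `w`, hence at most `z w ≤ z v`.
    · have h1 := hlast.resolve_left hwu.ne
      have h2 := (h.rowSplit w hw1 hwu).rest_le
      have h3 := hz w (by omega) hwu
      linarith
    · linarith
  have hM : ∀ a b, (MinEntropy.innerStep q z u st v).M a b
      = if a = v ∧ b = v then sp.d else if (v + 1 ≤ a ∧ a < w) ∧ b = v then st.R a
        else st.M a b := by
    intro a b
    simp only [MinEntropy.innerStep, ← hsp, hQ, Finset.mem_Ico]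
  have hR' : ∀ a, (MinEntropy.innerStep q z u st v).R a
      = if a = v then sp.r else if v + 1 ≤ a ∧ a < w then 0 else st.R a := by
    intro a
    simp only [MinEntropy.innerStep, ← hsp, hQ, Finset.mem_Ico]
  have hfree : ∀ a b, a < u → b ≤ v → st.M a b = 0 := fun a b ha hb => by
    rw [h.unchanged a b (by omega), h0 a b ha (by omega)]
  refine ⟨?_, ?_, ?_, ?_⟩
  · intro a b hab
    rw [hM, if_neg (by omega), if_neg (by omega)]
    exact h.unchanged a b (by omega)
  · intro t h1 h2
    by_cases htv : t = v
    · subst htv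
      have e : ∀ c < t, (MinEntropy.innerStep q z u st t).M t c = 0 := fun c hc => by
        rw [hM, if_neg (by omega), if_neg (by omega), hfree t c h2 hc.le]
      refine ⟨by rwa [hR', if_pos rfl], by rwa [hM, if_pos ⟨rfl, rfl⟩], 0, hv, ?_, ?_, ?_, ?_⟩
      · rw [e 0 hv]
      · rw [e 0 hv, hM, if_pos ⟨rfl, rfl⟩, hR', if_pos rfl, hr]
        ring
      · exact fun _ => e 0 hv
      · exact fun c hc _ => e c hc
    · have hrow := h.rowSplit t (by omega) h2
      by_cases htw : t < w
      · rw [hR', if_neg htv, if_pos ⟨by omega, htw⟩]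
        refine hrow.move (d := v) (by omega) (hfree t v h2 le_rfl) ?_ fun c hc => ?_
        · rw [hM, if_neg (by omega), if_pos ⟨⟨by omega, htw⟩, rfl⟩]
        · rw [hM, if_neg (by omega), if_neg (by omega)]
      · have e : (MinEntropy.innerStep q z u st v).M t = st.M t := by
          funext c
          rw [hM, if_neg (by omega), if_neg (by omega)]
        rw [hR', if_neg htv, if_neg (by omega), e]
        exact hrow
  · have hRs : ∑ t ∈ Finset.Ico v u, (MinEntropy.innerStep q z u st v).R t
        = sp.r + ∑ t ∈ Finset.Ico w u, st.R t := by
      rw [Finset.sum_eq_sum_Ico_succ_bot hvu, hR', if_pos rfl,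
        ← Finset.sum_Ico_consecutive _ hw1 hw2]
      congr 1
      rw [Finset.sum_eq_zero (s := Finset.Ico (v + 1) w), zero_add]
      · refine Finset.sum_congr rfl fun t ht => ?_
        rw [Finset.mem_Ico] at ht
        rw [hR', if_neg (by omega), if_neg (by omega)]
      · intro t ht
        rw [Finset.mem_Ico] at ht
        rw [hR', if_neg (by omega), if_pos ht]
    have hsplit := Finset.sum_Ico_consecutive st.R hw1 hw2
    rw [hRs, hr, hd]
    linarith
  · intro a b h1 h2 h3 hne
    rw [hM] at hne
    split_ifs at hne with c1 c2
    · obtain ⟨rfl, rfl⟩ := c1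
      have hdpos : 0 < sp.d := lt_of_le_of_ne hd0 (Ne.symm hne)
      have hs : 0 ≤ ∑ k ∈ Finset.Ico (b + 1) w, st.R k :=
        Finset.sum_nonneg fun k hk => by
          rw [Finset.mem_Ico] at hk
          exact hR k hk.1 (by omega)
      constructor <;> linarith
    · obtain ⟨c3, rfl⟩ := c2
      have hpos : 0 < st.R a := lt_of_le_of_ne (hR a c3.1 h3) (Ne.symm hne)
      have hs : st.R a ≤ ∑ k ∈ Finset.Ico (b + 1) w, st.R k :=
        Finset.single_le_sum (f := st.R) (fun k hk => by
          rw [Finset.mem_Ico] at hk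
          exact hR k hk.1 (by omega)) (Finset.mem_Ico.mpr c3)
      have hc := hcont.resolve_left (by omega)
      have h4 := (h.rowSplit a c3.1 h3).rest_le
      constructor <;> linarith
    · by_cases hb : b = v
      · exact absurd (hfree a b h3 hb.le) hne
      · exact h.support a b (by omega) h2 h3 hne

theorem filledFrom_foldl {q z : ℕ → ℝ} {l u : ℕ} {st₀ : State} (hl : 1 ≤ l)
    (hq : ∀ t, 0 ≤ q t) (hz : ∀ s t, 1 ≤ s → s ≤ t → z t ≤ z s)
    (h0 : ∀ a b, a < u → b < u → st₀.M a b = 0)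
    (hle : ∀ v, l ≤ v → v < u → ∑ t ∈ Finset.Ico v u, q t ≤ ∑ t ∈ Finset.Ico v u, z t)
    {v : ℕ} (hv : v ≤ u) (hlv : l ≤ v) :
    FilledFrom q z u st₀ v ((List.range' v (u - v)).reverse.foldl (innerStep q z u) st₀) := by
  induction hv using Nat.decreasingInduction with
  | self =>
    simp only [Nat.sub_self, List.range'_zero, List.reverse_nil, List.foldl_nil]
    exact ⟨fun _ _ _ => rfl, fun t h1 h2 => by omega, by simp, fun a b h1 h2 h3 => by omega⟩
  | of_succ v hvu ih =>
    rw [show u - v = (u - (v + 1)) + 1 by omega, List.range'_succ, List.reverse_cons,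
      List.foldl_append]
    exact (ih (by omega)).innerStep (by omega) hvu (hq v) (fun t h1 _ => hz v t (by omega) h1) h0
      (hle v hlv hvu)

/-- The cells `(a, b)` with `max a b = t` form a hook with corner `(t, t)`. All entries in the hook
vanish, except for the corner and one more entry; these two are non-negative and sum to `w`. -/
def HookSplit (M : ℕ → ℕ → ℝ) (w : ℝ) (t : ℕ) : Prop :=
  0 ≤ M t t ∧ ∃ a b, max a b = t ∧ (a, b) ≠ (t, t) ∧ 0 ≤ M a b ∧ M t t + M a b = w ∧
    ∀ a' b', max a' b' = t → (a', b') ≠ (t, t) → (a', b') ≠ (a, b) → M a' b' = 0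

theorem HookSplit.transpose {M : ℕ → ℕ → ℝ} {w : ℝ} {t : ℕ} (h : HookSplit M w t) :
    HookSplit (fun a b => M b a) w t := by
  obtain ⟨h1, a, b, h2, h3, h4, h5, h6⟩ := h
  refine ⟨h1, b, a, by rwa [max_comm], ?_, h4, h5, fun a' b' k1 k2 k3 => ?_⟩
  · simp only [ne_eq, Prod.mk.injEq] at h3 ⊢
    tauto
  · refine h6 b' a' (by rwa [max_comm]) ?_ ?_
    · simp only [ne_eq, Prod.mk.injEq] at k2 ⊢
      tauto
    · simp only [ne_eq, Prod.mk.injEq] at k3 ⊢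
      tauto

theorem RowSplit.hookSplit {M : ℕ → ℕ → ℝ} {w : ℝ} {t : ℕ} (h : RowSplit (M t) 0 w t)
    (h0 : ∀ a < t, M a t = 0) : HookSplit M w t := by
  obtain ⟨-, ht, c, hc, hfc, hsum, -, hz⟩ := h
  refine ⟨ht, t, c, max_eq_left hc.le, ?_, hfc, by linarith, fun a b h1 h2 h3 => ?_⟩
  · simp only [ne_eq, Prod.mk.injEq]
    omega
  · simp only [ne_eq, Prod.mk.injEq] at h2 h3
    by_cases ha : a = t
    · subst ha
      exact hz b (by omega) (by omega)
    · obtain rfl : b = t := by omega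
      exact h0 a (by omega)

/-- An odd stage on the segment `l, …, u - 1` completes the hooks with corner in the segment and
changes nothing outside them. When `l = 1` no column is left to take the remaining rests, which is
why the masses then have to balance exactly. -/
theorem oddStage_spec {p q z : ℕ → ℝ} {l u : ℕ} {st₀ : State} (hl : 1 ≤ l) (hlu : l < u)
    (hq : ∀ t, 0 ≤ q t) (hz : ∀ s t, 1 ≤ s → s ≤ t → z t ≤ z s)
    (hzp : ∀ t, l ≤ t → t < u → z t ≤ p t)
    (h0 : ∀ a b, a < u → b < u → st₀.M a b = 0)
    (hle : ∀ v, l ≤ v → v < u → ∑ t ∈ Finset.Ico v u, q t ≤ ∑ t ∈ Finset.Ico v u, z t)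
    (h1 : l = 1 → ∑ t ∈ Finset.Ico 1 u, q t = ∑ t ∈ Finset.Ico 1 u, z t)
    (hql : l ≠ 1 → 0 < q (l - 1)) :
    (∀ a b, ¬ (l ≤ a ∧ a < u ∧ b ≤ a) → (oddStage q z l u st₀).M a b = st₀.M a b) ∧
    (∀ t, l ≤ t → t < u → HookSplit (oddStage q z l u st₀).M (z t) t) ∧
    ∀ a b, l ≤ a → a < u → b ≤ a → (oddStage q z l u st₀).M a b ≠ 0 → 0 < p a ∧ 0 < q b := by
  have hF := filledFrom_foldl hl hq hz h0 hle hlu.le le_rfl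
  unfold oddStage
  set st := (List.range' l (u - l)).reverse.foldl (innerStep q z u) st₀
  have hcol : ∀ t, t < u → ∀ a < t, st.M a t = 0 := fun t ht a hat => by
    rw [hF.unchanged a t (by omega), h0 a t (by omega) ht]
  have hfree : ∀ a b, a < u → b < l → st.M a b = 0 := fun a b ha hb => by
    rw [hF.unchanged a b (by omega), h0 a b ha (by omega)]
  by_cases hl1 : l = 1
  · subst hl1
    -- The balance of the last segment leaves no rest.
    have hR : ∀ t ∈ Finset.Ico 1 u, st.R t = 0 := by
      have hs : ∑ t ∈ Finset.Ico 1 u, st.R t = 0 := by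
        have := hF.balance
        linarith [h1 rfl]
      refine (Finset.sum_eq_zero_iff_of_nonneg fun t ht => ?_).mp hs
      rw [Finset.mem_Ico] at ht
      exact (hF.rowSplit t ht.1 ht.2).1
    have e : flush 1 u st = st := by simp [flush]
    rw [e]
    refine ⟨fun a b hab => hF.unchanged a b (by omega), fun t h2 h3 => ?_,
      fun a b h2 h3 h4 hne => ?_⟩
    · have := hF.rowSplit t h2 h3
      rw [hR t (Finset.mem_Ico.mpr ⟨h2, h3⟩)] at this
      exact this.hookSplit (hcol t h3)
    · by_cases hb : b < 1
      · exact absurd (hfree a b h3 hb) hne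
      · have := hF.support a b (by omega) h4 h3 hne
        exact ⟨this.1.trans_le (hzp a h2 h3), this.2⟩
  · have hM : ∀ a b, (flush l u st).M a b
        = if (l ≤ a ∧ a < u ∧ st.R a ≠ 0) ∧ b = l - 1 then st.R a else st.M a b := by
      intro a b
      simp only [flush, if_pos (show l ≠ 1 from hl1)]
    refine ⟨fun a b hab => ?_, fun t h2 h3 => ?_, fun a b h2 h3 h4 hne => ?_⟩
    · rw [hM, if_neg (by omega)]
      exact hF.unchanged a b (by omega)
    · refine RowSplit.hookSplit ?_ fun a ha => ?_
      · refine (hF.rowSplit t h2 h3).move (d := l - 1) (by omega) (hfree t _ h3 (by omega)) ?_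
          fun c hc => ?_
        · rw [hM]
          split_ifs with h
          · rfl
          · have : st.R t = 0 := by
              by_contra hne
              exact h ⟨⟨h2, h3, hne⟩, rfl⟩
            rw [this]
            exact hfree t _ h3 (by omega)
        · rw [hM, if_neg (fun h => hc h.2)]
      · rw [hM, if_neg (by omega)]
        exact hcol t h3 a ha
    · rw [hM] at hne
      split_ifs at hne with h
      · obtain ⟨-, rfl⟩ := h
        have hrow := hF.rowSplit a h2 h3
        have hpos : 0 < st.R a := lt_of_le_of_ne hrow.1 (Ne.symm hne)
        exact ⟨(hpos.trans_le hrow.rest_le).trans_le (hzp a h2 h3), hql hl1⟩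
      · by_cases hb : b < l
        · exact absurd (hfree a b h3 hb) hne
        · have := hF.support a b (by omega) h4 h3 hne
          exact ⟨this.1.trans_le (hzp a h2 h3), this.2⟩

/-! ### The main loop -/

/-- The properties of the two inputs `p`, `q` and of `z = p ∧ q`, in terms of suffix sums, that the
main loop relies on. They are symmetric in `p` and `q`. -/
structure MeetData (N : ℕ) (p q z : ℕ → ℝ) : Prop where
  p_nonneg : ∀ t, 0 ≤ p t
  q_nonneg : ∀ t, 0 ≤ q t
  z_anti : ∀ s t, 1 ≤ s → s ≤ t → z t ≤ z s
  suffix : ∀ i, 1 ≤ i → i ≤ N + 1 → suffixSum N z i = max (suffixSum N p i) (suffixSum N q i)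
  total : suffixSum N p 1 = suffixSum N q 1

theorem MeetData.symm {N : ℕ} {p q z : ℕ → ℝ} (h : MeetData N p q z) : MeetData N q p z :=
  ⟨h.q_nonneg, h.p_nonneg, h.z_anti, fun i h1 h2 => by rw [h.suffix i h1 h2, max_comm],
    h.total.symm⟩

theorem meetData_comp {a b : List ℝ} (ha : IsOrderedDist a) (hb : IsOrderedDist b) :
    MeetData (max a.length b.length) (comp a) (comp b) (comp (meet a b)) := by
  have hz := meet_isOrderedDist ha hb
  refine ⟨comp_nonneg ha, comp_nonneg hb, fun s t h1 h2 => comp_anti hz h1 h2,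
    fun i h1 h2 => ?_, ?_⟩
  · rw [suffixSum_comp hz (length_meet a b).le h1 h2, suffixSum_comp ha (le_max_left _ _) h1 h2,
      suffixSum_comp hb (le_max_right _ _) h1 h2, prefixSum_meet]
    exact (max_sub_sub_left _ _ _).symm
  · rw [suffixSum_comp ha (le_max_left _ _) le_rfl (by omega),
      suffixSum_comp hb (le_max_right _ _) le_rfl (by omega), prefixSum_zero, prefixSum_zero]

theorem suffixSum_eq_add (p : ℕ → ℝ) {N i : ℕ} (h : i ≤ N) :
    suffixSum N p i = p i + suffixSum N p (i + 1) := by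
  rw [suffixSum_eq_sum_Ico, Finset.sum_eq_sum_Ico_succ_bot (by omega)]
  rfl

theorem MeetData.z_le {N : ℕ} {p q z : ℕ → ℝ} (h : MeetData N p q z) {t : ℕ} (h1 : 1 ≤ t)
    (hN : t ≤ N) (hpq : suffixSum N q t ≤ suffixSum N p t) : z t ≤ p t := by
  have e1 := suffixSum_eq_add p hN
  have e2 := suffixSum_eq_add z hN
  rw [h.suffix t h1 (by omega), h.suffix (t + 1) (by omega) (by omega), max_eq_left hpq] at e2
  linarith [le_max_left (suffixSum N p (t + 1)) (suffixSum N q (t + 1))]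

/-- `u` is an upper end at which a segment with `p` on top may start: below `u` the suffix sums of
`p` dominate, while at `u` itself those of `q` do. -/
structure TurnsAt (N : ℕ) (p q : ℕ → ℝ) (u : ℕ) : Prop where
  one_le : 1 ≤ u
  le_succ : u ≤ N + 1
  at_u : suffixSum N p u ≤ suffixSum N q u
  below : u ≠ 1 → suffixSum N q (u - 1) ≤ suffixSum N p (u - 1)

theorem nextInversion_spec {N : ℕ} {p q : ℕ → ℝ} {u : ℕ} (h : TurnsAt N p q u) (hu : u ≠ 1) :
    1 ≤ nextInversion N p q u ∧ nextInversion N p q u < u ∧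
      (∀ i, nextInversion N p q u ≤ i → i < u → suffixSum N q i ≤ suffixSum N p i) ∧
      (nextInversion N p q u ≠ 1 →
        suffixSum N p (nextInversion N p q u - 1) < suffixSum N q (nextInversion N p q u - 1)) := by
  have hu1 := h.one_le
  have hne : {l | 1 ≤ l ∧ l < u ∧ ∀ i, l ≤ i → i < u →
      suffixSum N q i ≤ suffixSum N p i}.Nonempty := by
    refine ⟨u - 1, by omega, by omega, fun i h1 h2 => ?_⟩
    obtain rfl : i = u - 1 := by omega
    exact h.below hu
  obtain ⟨h1, h2, h3⟩ : 1 ≤ nextInversion N p q u ∧ nextInversion N p q u < u ∧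
      ∀ i, nextInversion N p q u ≤ i → i < u → suffixSum N q i ≤ suffixSum N p i :=
    Nat.sInf_mem hne
  refine ⟨h1, h2, h3, fun hl => ?_⟩
  by_contra hc
  rw [not_lt] at hc
  refine Nat.notMem_of_lt_sInf (show nextInversion N p q u - 1 < nextInversion N p q u by omega)
    ⟨by omega, by omega, fun i h4 h5 => ?_⟩
  by_cases hi : i = nextInversion N p q u - 1
  · rwa [hi]
  · exact h3 i (by omega) h5

theorem TurnsAt.next {N : ℕ} {p q : ℕ → ℝ} {u : ℕ} (h : TurnsAt N p q u) (hu : u ≠ 1) :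
    TurnsAt N q p (nextInversion N p q u) := by
  obtain ⟨h1, h2, h3, h4⟩ := nextInversion_spec h hu
  have := h.le_succ
  exact ⟨h1, by omega, h3 _ le_rfl h2, fun hl => (h4 hl).le⟩

/-- The invariant of the main loop: the hooks with corner at `u` or beyond are complete, the other
ones are still empty, and non-zero entries occur only where both marginals are positive. -/
structure HooksFrom (p q z : ℕ → ℝ) (u : ℕ) (M : ℕ → ℕ → ℝ) : Prop where
  empty : ∀ a b, a < u → b < u → M a b = 0
  hook : ∀ t, u ≤ t → HookSplit M (z t) t
  support : ∀ a b, M a b ≠ 0 → 0 < p a ∧ 0 < q b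

theorem HooksFrom.transpose {p q z : ℕ → ℝ} {u : ℕ} {M : ℕ → ℕ → ℝ} (h : HooksFrom p q z u M) :
    HooksFrom q p z u (fun a b => M b a) :=
  ⟨fun a b ha hb => h.empty b a hb ha, fun t ht => (h.hook t ht).transpose,
    fun a b hab => (h.support b a hab).symm⟩

theorem HookSplit.congr {M M' : ℕ → ℕ → ℝ} {w : ℝ} {t : ℕ} (h : HookSplit M w t)
    (e : ∀ a b, max a b = t → M' a b = M a b) : HookSplit M' w t := by
  obtain ⟨h1, a, b, h2, h3, h4, h5, h6⟩ := h
  refine ⟨by rwa [e t t (max_self t)], a, b, h2, h3, by rwa [e a b h2], ?_, fun a' b' k1 k2 k3 => ?_⟩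
  · rwa [e t t (max_self t), e a b h2]
  · rw [e a' b' k1]
    exact h6 a' b' k1 k2 k3

theorem HooksFrom.oddStage {N : ℕ} {p q z : ℕ → ℝ} {u : ℕ} {st : State} (hd : MeetData N p q z)
    (hq : ∀ s t, 1 ≤ s → s ≤ t → q t ≤ q s)
    (ht : TurnsAt N p q u) (hu : u ≠ 1) (h : HooksFrom p q z u st.M) :
    HooksFrom p q z (nextInversion N p q u) (oddStage q z (nextInversion N p q u) u st).M := by
  obtain ⟨h1, h2, h3, h4⟩ := nextInversion_spec ht hu
  set l := nextInversion N p q u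
  have huN := ht.le_succ
  -- On `l, …, u - 1` the suffix sums of `z` are those of `p`, and at `u` they are those of `q`.
  have hsum : ∀ v, l ≤ v → v < u →
      ∑ t ∈ Finset.Ico v u, z t = suffixSum N p v - suffixSum N q u := fun v k1 k2 => by
    rw [sum_Ico_eq_suffixSum_sub z k2.le huN, hd.suffix v (by omega) (by omega),
      hd.suffix u ht.one_le huN, max_eq_left (h3 v k1 k2), max_eq_right ht.at_u]
  obtain ⟨k1, k2, k3⟩ := oddStage_spec (p := p) h1 h2 hd.q_nonneg hd.z_anti
    (fun t g1 g2 => hd.z_le (by omega) (by omega) (h3 t g1 g2)) h.empty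
    (fun v g1 g2 => by
      rw [hsum v g1 g2, sum_Ico_eq_suffixSum_sub q g2.le huN]
      linarith [h3 v g1 g2])
    (fun hl => by
      rw [hsum 1 hl.le (by omega), sum_Ico_eq_suffixSum_sub q (by omega) huN, hd.total])
    (fun hl => by
      -- All `q t` with `t ≥ l - 1` would vanish, although their sum exceeds a non-negative one.
      by_contra hc
      have hlt := h4 hl
      have hp : 0 ≤ suffixSum N p (l - 1) := Finset.sum_nonneg fun t _ => hd.p_nonneg t
      have hq' : suffixSum N q (l - 1) ≤ 0 := Finset.sum_nonpos fun t g => by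
        rw [Finset.mem_Icc] at g
        exact (hq (l - 1) t (by omega) g.1).trans (not_lt.mp hc)
      linarith)
  refine ⟨fun a b ha hb => ?_, fun t g => ?_, fun a b hab => ?_⟩
  · rw [k1 a b (by omega)]
    exact h.empty a b (by omega) (by omega)
  · by_cases htu : t < u
    · exact k2 t g htu
    · refine (h.hook t (by omega)).congr fun a b hab => k1 a b ?_
      omega
  · by_cases hc : l ≤ a ∧ a < u ∧ b ≤ a
    · exact k3 a b hc.1 hc.2.1 hc.2.2 hab
    · rw [k1 a b hc] at hab
      exact h.support a b hab

theorem inversionPoint_succ (N : ℕ) (p q : ℕ → ℝ) (s : ℕ) :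
    inversionPoint N p q (s + 1) = if Even s then nextInversion N p q (inversionPoint N p q s)
      else nextInversion N q p (inversionPoint N p q s) := by
  rw [inversionPoint]
  simp only [Nat.odd_add_one, Nat.not_odd_iff_even]

/-- As long as the inversion points have not reached `1`, they alternate between the two signs. -/
theorem turnsAt_inversionPoint {N : ℕ} {p q : ℕ → ℝ} (h : TurnsAt N p q (N + 1)) {s : ℕ}
    (hs : ∀ r < s, inversionPoint N p q r ≠ 1) :
    (Even s → TurnsAt N p q (inversionPoint N p q s)) ∧
      (¬ Even s → TurnsAt N q p (inversionPoint N p q s)) := by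
  induction s with
  | zero => exact ⟨fun _ => h, fun h => absurd Even.zero h⟩
  | succ s ih =>
    have ih := ih fun r hr => hs r (by omega)
    rw [Nat.even_add_one, not_not, inversionPoint_succ]
    refine ⟨fun he => ?_, fun he => ?_⟩
    · rw [if_neg he]
      exact (ih.2 he).next (hs s (by omega))
    · rw [if_pos he]
      exact (ih.1 he).next (hs s (by omega))

theorem exists_inversionPoint_eq_one {N : ℕ} {p q : ℕ → ℝ} (h : TurnsAt N p q (N + 1)) :
    ∃ s, inversionPoint N p q s = 1 := by
  by_contra hc
  rw [not_exists] at hc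
  have hdec : ∀ s, inversionPoint N p q s + s ≤ N + 1 := by
    intro s
    induction s with
    | zero => simp [inversionPoint]
    | succ s ih =>
      have ht := turnsAt_inversionPoint h (s := s) fun r _ => hc r
      rw [inversionPoint_succ]
      split_ifs with he
      · have := (nextInversion_spec (ht.1 he) (hc s)).2.1
        omega
      · have := (nextInversion_spec (ht.2 he) (hc s)).2.1
        omega
  have := hdec (N + 2)
  omega

theorem hooksFrom_foldl_stage {N : ℕ} {p q z : ℕ → ℝ} {st : State} (hd : MeetData N p q z)
    (hp : ∀ s t, 1 ≤ s → s ≤ t → p t ≤ p s) (hq : ∀ s t, 1 ≤ s → s ≤ t → q t ≤ q s)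
    (ht : TurnsAt N p q (N + 1)) (h : HooksFrom p q z (N + 1) st.M) {s : ℕ}
    (hs : ∀ r < s, inversionPoint N p q r ≠ 1) :
    HooksFrom p q z (inversionPoint N p q s)
      ((List.range' 1 s).foldl (stage N p q z) st).M := by
  induction s with
  | zero => exact h
  | succ s ih =>
    have ih := ih fun r hr => hs r (by omega)
    have htu := turnsAt_inversionPoint ht (s := s) fun r hr => hs r (by omega)
    rw [List.range'_concat, List.foldl_append, inversionPoint_succ]
    simp only [List.foldl_cons, List.foldl_nil, one_mul]
    rw [stage, add_comm 1 s, Nat.add_sub_cancel, inversionPoint_succ]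
    by_cases he : Even s
    · rw [if_pos he, if_pos he.add_one]
      exact ih.oddStage hd hq (htu.1 he) (hs s (by omega))
    · rw [if_neg he, if_neg (by rwa [Nat.odd_add_one, Nat.not_odd_iff_even])]
      exact (HooksFrom.oddStage (st := State.swap _) hd.symm hp (htu.2 he) (hs s (by omega))
        ih.transpose).transpose

theorem hooksFrom_jointCore {a b : List ℝ} (ha : IsOrderedDist a) (hb : IsOrderedDist b)
    (hab : comp b (max a.length b.length) ≤ comp a (max a.length b.length)) :
    HooksFrom (comp a) (comp b) (comp (meet a b)) 1 (jointCore a b) := by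
  have hN : 1 ≤ max a.length b.length := le_max_of_le_left (length_pos_of_isOrderedDist ha)
  have ht : TurnsAt (max a.length b.length) (comp a) (comp b) (max a.length b.length + 1) := by
    refine ⟨by omega, le_rfl, by simp [suffixSum], fun _ => ?_⟩
    simpa [suffixSum] using hab
  have hz : ∀ t, max a.length b.length + 1 ≤ t → comp (meet a b) t = 0 := fun t ht => by
    by_contra hne
    have hpos := lt_of_le_of_ne (comp_nonneg (meet_isOrderedDist ha hb) t) (Ne.symm hne)
    have := (Finset.mem_Icc.mp (mem_Icc_of_comp_pos hpos)).2
    rw [length_meet] at this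
    omega
  have hex := exists_inversionPoint_eq_one ht
  have key := hooksFrom_foldl_stage (meetData_comp ha hb) (fun s t => comp_anti ha)
    (fun s t => comp_anti hb) ht
    (st := { M := fun _ _ => 0, R := fun _ => 0, C := fun _ => 0 })
    ⟨fun _ _ _ _ => rfl, fun t h => ?_, fun _ _ h => absurd rfl h⟩
    (s := inversionCount (max a.length b.length) (comp a) (comp b))
    fun r hr h1 => Nat.notMem_of_lt_sInf hr h1
  · have h1 : inversionPoint (max a.length b.length) (comp a) (comp b)
        (inversionCount (max a.length b.length) (comp a) (comp b)) = 1 := Nat.sInf_mem hex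
    rwa [h1] at key
  · refine ⟨le_rfl, t, 0, by simp, ?_, le_rfl, ?_, fun _ _ _ _ _ => rfl⟩
    · simp only [ne_eq, Prod.mk.injEq]
      omega
    · rw [hz t h, add_zero]

theorem meet_comm (a b : List ℝ) : meet a b = meet b a := by
  simp only [meet, max_comm, min_comm]

theorem hooksFrom_minEntropyJoint {a b : List ℝ} (ha : IsOrderedDist a) (hb : IsOrderedDist b) :
    HooksFrom (comp a) (comp b) (comp (meet a b)) 1 (minEntropyJoint a b) := by
  have hN : 1 ≤ max a.length b.length := le_max_of_le_left (length_pos_of_isOrderedDist ha)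
  unfold minEntropyJoint
  split_ifs with h
  · rw [meet_comm]
    refine (hooksFrom_jointCore hb ha ?_).transpose
    obtain ⟨i, hi, h1, h2⟩ := h
    rw [max_comm]
    rcases (Finset.mem_Icc.mp hi).2.lt_or_eq with hlt | rfl
    · exact (h2 _ (Finset.mem_Ioc.mpr ⟨hlt, le_rfl⟩)).le
    · exact h1.le
  · refine hooksFrom_jointCore ha hb ?_
    by_contra hc
    exact h ⟨_, Finset.mem_Icc.mpr ⟨hN, le_rfl⟩, not_le.mp hc, by simp⟩

/-! ### The entries of the joint distribution -/

section

variable {p q : ℕ → ℝ} {z : List ℝ} {M : ℕ → ℕ → ℝ}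

theorem HooksFrom.nonneg (h : HooksFrom p q (comp z) 1 M) (a b : ℕ) : 0 ≤ M a b := by
  by_cases hab : a < 1 ∧ b < 1
  · exact (h.empty a b hab.1 hab.2).ge
  · obtain ⟨h1, a', b', h2, h3, h4, h5, h6⟩ := h.hook (max a b) (by omega)
    by_cases e1 : (a, b) = (max a b, max a b)
    · obtain ⟨ha, hb⟩ := Prod.mk.injEq .. ▸ e1
      rw [← ha] at hb
      rw [← ha] at h1
      rwa [hb]
    · by_cases e2 : (a, b) = (a', b')
      · obtain ⟨rfl, rfl⟩ := Prod.mk.injEq .. ▸ e2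
        exact h4
      · exact (h6 a b rfl e1 e2).ge

/-- The first `K` hooks contain at most `2 * K` non-zero entries, and these sum to
`z₁ + ⋯ + z_K`. -/
theorem HooksFrom.exists_cells (h : HooksFrom p q (comp z) 1 M) (K : ℕ) :
    ∃ T : Finset (ℕ × ℕ), T.card ≤ 2 * K ∧ (∀ c ∈ T, max c.1 c.2 ≤ K) ∧
      ∑ c ∈ T, M c.1 c.2 = prefixSum z K ∧
      ∀ c : ℕ × ℕ, max c.1 c.2 ≤ K → c ∉ T → M c.1 c.2 = 0 := by
  induction K with
  | zero =>
    refine ⟨∅, by simp, by simp, by simp [prefixSum_zero], fun c hc _ => ?_⟩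
    exact h.empty _ _ (by omega) (by omega)
  | succ K ih =>
    obtain ⟨T, hcard, hmax, hsum, hzero⟩ := ih
    obtain ⟨h1, a, b, h2, h3, h4, h5, h6⟩ := h.hook (K + 1) (by omega)
    have n1 : (a, b) ∉ T := fun hc => by
      have := hmax _ hc
      simp only at this
      omega
    have n2 : (K + 1, K + 1) ∉ insert (a, b) T := fun hc => by
      rcases Finset.mem_insert.mp hc with hc | hc
      · exact h3 hc.symm
      · have := hmax _ hc
        simp at this
    refine ⟨insert (K + 1, K + 1) (insert (a, b) T), ?_, ?_, ?_, ?_⟩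
    · rw [Finset.card_insert_of_notMem n2, Finset.card_insert_of_notMem n1]
      omega
    · intro c hc
      rcases Finset.mem_insert.mp hc with rfl | hc
      · simp
      · rcases Finset.mem_insert.mp hc with rfl | hc
        · exact h2.le
        · exact (hmax c hc).trans (Nat.le_succ K)
    · rw [Finset.sum_insert n2, Finset.sum_insert n1, hsum, prefixSum_succ_eq_comp]
      linarith
    · intro c hc hn
      rw [Finset.mem_insert, Finset.mem_insert, not_or, not_or] at hn
      rcases Nat.le_succ_iff.mp hc with hle | heq
      · exact hzero c hle hn.2.2
      · exact h6 c.1 c.2 heq hn.1 hn.2.1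

/-- The larger one of the two entries in the next hook is at least half of their sum. -/
theorem HooksFrom.exists_cells_odd (h : HooksFrom p q (comp z) 1 M) (K : ℕ) :
    ∃ T : Finset (ℕ × ℕ), T.card ≤ 2 * K + 1 ∧
      (prefixSum z K + prefixSum z (K + 1)) / 2 ≤ ∑ c ∈ T, M c.1 c.2 := by
  obtain ⟨T, hcard, hmax, hsum, -⟩ := h.exists_cells K
  obtain ⟨-, a, b, h2, -, -, h5, -⟩ := h.hook (K + 1) (by omega)
  obtain ⟨c, hc, hle⟩ : ∃ c : ℕ × ℕ, max c.1 c.2 = K + 1 ∧ comp z (K + 1) / 2 ≤ M c.1 c.2 := by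
    rcases le_total (M (K + 1) (K + 1)) (M a b) with hle | hle
    · exact ⟨(a, b), h2, by simp only; linarith⟩
    · exact ⟨(K + 1, K + 1), by simp, by simp only; linarith⟩
  have hn : c ∉ T := fun hc' => by
    have := hmax c hc'
    omega
  refine ⟨insert c T, by rw [Finset.card_insert_of_notMem hn]; omega, ?_⟩
  rw [Finset.sum_insert hn, hsum, prefixSum_succ_eq_comp]
  linarith

end

theorem coe_entries (M : ℕ → ℕ → ℝ) (n m : ℕ) :
    (entries M n m : Multiset ℝ)
      = (Finset.Icc 1 n ×ˢ Finset.Icc 1 m).val.map fun c => M c.1 c.2 := by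
  have e1 : (Finset.Icc 1 n).val = (List.range' 1 n : Multiset ℕ) := rfl
  have e2 : (Finset.Icc 1 m).val = (List.range' 1 m : Multiset ℕ) := rfl
  rw [Finset.product_val, e1, e2, Multiset.coe_product, Multiset.map_coe]
  simp [entries, List.product, SProd.sprod, List.map_flatMap, Function.comp_def]

theorem coe_combine (a b : List ℝ) :
    (combine a b : Multiset ℝ)
      = ((Finset.Icc 1 a.length ×ˢ Finset.Icc 1 b.length).val.map
          fun c => minEntropyJoint a b c.1 c.2).filter (· ≠ 0) := by
  rw [← coe_entries, Multiset.filter_coe, combine]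
  exact Multiset.coe_eq_coe.mpr ((sortDesc_perm _).trans (by rfl))

theorem sum_filter_ne_zero (S : Multiset ℝ) : (S.filter (· ≠ 0)).sum = S.sum := by
  induction S using Multiset.induction_on with
  | empty => simp
  | cons x S ih => by_cases hx : x = 0 <;> simp [hx, ih]

section

variable {a b : List ℝ}

theorem mem_grid_of_ne_zero (ha : IsOrderedDist a) (hb : IsOrderedDist b) {c : ℕ × ℕ}
    (hc : minEntropyJoint a b c.1 c.2 ≠ 0) :
    c ∈ Finset.Icc 1 a.length ×ˢ Finset.Icc 1 b.length :=
  have h := (hooksFrom_minEntropyJoint ha hb).support _ _ hc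
  Finset.mem_product.mpr ⟨mem_Icc_of_comp_pos h.1, mem_Icc_of_comp_pos h.2⟩

theorem combine_isOrderedDist (ha : IsOrderedDist a) (hb : IsOrderedDist b) :
    IsOrderedDist (combine a b) := by
  have h := hooksFrom_minEntropyJoint ha hb
  refine ⟨sortDesc_pairwise _, fun x hx => ?_, ?_⟩
  · rw [← Multiset.mem_coe, coe_combine] at hx
    obtain ⟨c, -, rfl⟩ := Multiset.mem_map.mp (Multiset.mem_of_mem_filter hx)
    exact h.nonneg _ _
  · obtain ⟨T, -, -, hsum, hzero⟩ := h.exists_cells (max a.length b.length)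
    rw [← Multiset.sum_coe, coe_combine, sum_filter_ne_zero]
    change ∑ c ∈ Finset.Icc 1 a.length ×ˢ Finset.Icc 1 b.length, minEntropyJoint a b c.1 c.2 = 1
    have hz := meet_isOrderedDist ha hb
    rw [prefixSum_of_le (length_meet a b).le, hz.2.2] at hsum
    rw [← hsum, Finset.sum_subset (Finset.subset_union_left (s₂ := T)),
      ← Finset.sum_subset (Finset.subset_union_right (s₂ := T))]
    · intro c hc hn
      have hc := (Finset.mem_union.mp hc).resolve_right hn
      rw [Finset.mem_product, Finset.mem_Icc, Finset.mem_Icc] at hc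
      exact hzero c (by omega) hn
    · intro c _ hn
      by_contra hne
      exact hn (mem_grid_of_ne_zero ha hb hne)

theorem sum_cells_le_prefixSum_combine (ha : IsOrderedDist a) (hb : IsOrderedDist b)
    (T : Finset (ℕ × ℕ)) {i : ℕ} (hT : T.card ≤ i) :
    ∑ c ∈ T, minEntropyJoint a b c.1 c.2 ≤ prefixSum (combine a b) i := by
  have ho := combine_isOrderedDist ha hb
  rw [← Finset.sum_filter_ne_zero]
  refine sum_le_prefixSum ho.1 ho.2.1
    (S := (T.filter fun c => minEntropyJoint a b c.1 c.2 ≠ 0).val.map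
      fun c => minEntropyJoint a b c.1 c.2) ?_ ?_
  · rw [coe_combine, Multiset.le_filter]
    refine ⟨Multiset.map_le_map (Finset.val_le_iff.mpr fun c hc => ?_), fun x hx => ?_⟩
    · exact mem_grid_of_ne_zero ha hb (Finset.mem_filter.mp hc).2
    · obtain ⟨c, hc, rfl⟩ := Multiset.mem_map.mp hx
      exact (Finset.mem_filter.mp hc).2
  · rw [Multiset.card_map]
    exact (Finset.card_filter_le _ _).trans hT

theorem half_meet_majorized_combine (ha : IsOrderedDist a) (hb : IsOrderedDist b) :
    Majorized (half (meet a b)) (combine a b) := by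
  have h := hooksFrom_minEntropyJoint ha hb
  refine ⟨half_isOrderedDist (meet_isOrderedDist ha hb), combine_isOrderedDist ha hb, fun i => ?_⟩
  obtain ⟨K, rfl | rfl⟩ := Nat.even_or_odd' i
  · obtain ⟨T, hcard, -, hsum, -⟩ := h.exists_cells K
    rw [prefixSum_half_even, ← hsum]
    exact sum_cells_le_prefixSum_combine ha hb T hcard
  · obtain ⟨T, hcard, hsum⟩ := h.exists_cells_odd K
    rw [prefixSum_half_odd]
    exact hsum.trans (sum_cells_le_prefixSum_combine ha hb T hcard)

end

/-! ### The binary tree -/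

theorem blockMeet_succ_le {n : ℕ} (p : ℕ → OrderedDist n) (ℓ s : ℕ) :
    blockMeet p (ℓ + 1) s ≤ blockMeet p ℓ (2 * s) ∧
      blockMeet p (ℓ + 1) s ≤ blockMeet p ℓ (2 * s + 1) := by
  constructor <;>
  · refine Finset.inf'_mono p (Finset.Icc_subset_Icc ?_ ?_) _ <;>
    · rw [pow_succ]
      nlinarith [Nat.one_le_two_pow (n := ℓ)]

theorem half_blockMeet_majorized {n : ℕ} (p : ℕ → OrderedDist n) (ℓ s : ℕ) :
    Majorized (half^[ℓ] (blockMeet p ℓ s).toList) (blockJoint p ℓ (s * 2 ^ ℓ + 1)) := by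
  induction ℓ generalizing s with
  | zero =>
    have e : blockMeet p 0 s = p (s + 1) := by
      have h : blockMeet p 0 s = ({s + 1} : Finset ℕ).inf' (Finset.singleton_nonempty _) p :=
        Finset.inf'_congr _ (by simp) fun _ _ => rfl
      rw [h, Finset.inf'_singleton]
    rw [e, pow_zero, mul_one, blockJoint, sortDesc_of_pairwise (p (s + 1)).ordered.1]
    exact le_refl (p (s + 1))
  | succ ℓ ih =>
    obtain ⟨h1, h2⟩ := blockMeet_succ_le p ℓ s
    have k1 := (Majorized.half_iterate_mono h1 ℓ).trans (ih (2 * s))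
    have k2 := (Majorized.half_iterate_mono h2 ℓ).trans (ih (2 * s + 1))
    rw [show 2 * s * 2 ^ ℓ + 1 = s * 2 ^ (ℓ + 1) + 1 by ring] at k1
    rw [show (2 * s + 1) * 2 ^ ℓ + 1 = s * 2 ^ (ℓ + 1) + 1 + 2 ^ ℓ by ring] at k2
    rw [Function.iterate_succ_apply', blockJoint]
    exact (k1.le_meet k2).half_mono.trans (half_meet_majorized_combine k1.2.1 k2.2.1)

end MinEntropy

theorem theorem3 (κ n : ℕ) (p : ℕ → MinEntropy.OrderedDist n)
    (ℓ : ℕ) (hℓ : ℓ ≤ κ) (s : ℕ) (hs : s < 2 ^ κ / 2 ^ ℓ) :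
    MinEntropy.Majorized
      (MinEntropy.half^[ℓ] (MinEntropy.blockMeet p ℓ s).toList)
      (MinEntropy.blockJoint p ℓ (s * 2 ^ ℓ + 1)) :=
  MinEntropy.half_blockMeet_majorized p ℓ s
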